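/- Let $q\ge 2$ be an integer. For $\alpha\in\mathbb Z_{\ge0}$ let $R^{\alpha}_{m,n}$ ($m,n\ge 0$) be the disk polynomials $$R^{\alpha}_{m,n}(z)=\sum_{j=0}^{\min(m,n)}(-1)^j\frac{\binom mj\binom nj}{\binom{\alpha+j}{j}}\,z^{m-j}\,\bar z^{\,n-j}\,(1-|z|^2)^j ,\qquad |z|\le 1,$$ so that $R^\alpha_{m,n}(1)=1$. For $p\ge2$, let $\Upsilon_{2p}$ be the class of continuous functions $\varphi:\{z\in\mathbb C:|z|\le1\}\to\mathbb C$ with $\varphi(1)=1$ such that $(z,w)\mapsto\varphi(z\cdot w)$, $z\cdot w=\sum_k z_k\overline{w_k}$, is positive definite on the unit sphere of $\mathbb C^p$, i.e. $\sum_{i,j}c_i\overline{c_j}\,\varphi(z_i\cdot z_j)\ge0$ for all finitely many distinct points $z_i$ of the sphere and all $c_i\in\mathbb C$. A pair $(\varphi,\{a_{m,n}\}_{m,n\ge0})$ is a $2p$-Schoenberg pair if $\varphi\in\Upsilon_{2p}$, $a_{m,n}\ge0$, $\sum_{m,n}a_{m,n}=1$ and $\varphi(z)=\sum_{m,n\ge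 0}a_{m,n}R^{p-2}_{m,n}(z)$ for all $|z|\le1$; then $\{a_{m,n}\}$ is called the $2p$-Schoenberg sequence of coefficients of $\varphi$. **Theorem.** Let $(\varphi,\{a^{q-1}_{m,n}\})$ be a $2(q+1)$-Schoenberg pair. Then there is exactly one sequence $\{a^{q-2}_{m,n}\}_{m,n\ge0}$ such that $(\varphi,\{a^{q-2}_{m,n}\})$ is a $2q$-Schoenberg pair. It satisfies $$a^{q-2}_{m,n}=\frac{m+n+q-1}{q-1}\binom{m+q-2}{q-2}\binom{n+q-2}{q-2}\int_{|z|\le1}\varphi(z)\,\overline{R^{q-2}_{m,n}(z)}\;\frac{q-1}{\pi}(1-|z|^2)^{q-2}\,dx\,dy ,\qquad z=x+\mathsf{i}y,$$ and it is given by the convergent series $$a^{q-2}_{m,n}=\sum_{j=0}^\infty v^{q-2}_{j,m+1,n}\,a^{q-1}_{m+j,n+j},\qquad m,n\ge0,$$ where, with the rising factorial $x^{(j)}=x(x+1)\cdots(x+j-1)$, $x^{(0)}=1$, $$v^{q-2}_{j,m,n}=\frac{(q-1)\,(m+n+q-2)\,m^{(j)}\,(n+1)^{(j)}}{(m+q-2)^{(j+1)}\,(n+q-1)^{(j+1)}},$$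 and $v^{q-2}_{j,m+1,n}>0$ for all $j,m,n\ge0$. -/

import Mathlib

open scoped ComplexConjugate

namespace ComplexSphere

/-- The disk polynomial `R^α_{m,n}` of bi-degree `(m, n)`, normalized by `R^α_{m,n}(1) = 1`:
`R^α_{m,n}(z) = ∑_j (-1)^j C(m,j) C(n,j) / C(α+j,j) * z^(m-j) * conj z^(n-j) * (1 - |z|^2)^j`.
With `z = r e^{iθ}`, `k = min m n`, this is
`r^|m-n| e^{i(m-n)θ} P_k^{(α,|m-n|)}(2r^2-1) / P_k^{(α,|m-n|)}(1)` for the Jacobi polynomials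
`P_k^{(α,β)}(x) = ∑_s C(k+α,k-s) C(k+β,s) ((x-1)/2)^s ((x+1)/2)^(k-s)`. -/
noncomputable def diskPoly (α m n : ℕ) (z : ℂ) : ℂ :=
  ∑ j ∈ Finset.range (min m n + 1),
    (-1 : ℂ) ^ j * ((m.choose j : ℂ) * (n.choose j : ℂ) / ((α + j).choose j : ℂ)) *
      z ^ (m - j) * conj z ^ (n - j) * (1 - (‖z‖ : ℂ) ^ 2) ^ j

/-- `h^α_{m,n}`, the reciprocal of the squared `L²(ν_α)` norm of `R^α_{m,n}`. -/
noncomputable def diskNormConst (α m n : ℕ) : ℝ :=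
  ((m : ℝ) + n + α + 1) / ((α : ℝ) + 1) * ((m + α).choose α : ℝ) * ((n + α).choose α : ℝ)

/-- The coefficient `h^α_{m,n} ∫ φ conj(R^α_{m,n}) dν_α` over the closed unit disk, where
`dν_α(z) = (α+1)/π (1 - |z|^2)^α dx dy`. -/
noncomputable def diskCoeff (α : ℕ) (φ : ℂ → ℂ) (m n : ℕ) : ℂ :=
  (diskNormConst α m n : ℂ) *
    ∫ z in Metric.closedBall (0 : ℂ) 1,
      φ z * conj (diskPoly α m n z) *
        (((((α : ℝ) + 1) / Real.pi) * (1 - ‖z‖ ^ 2) ^ α : ℝ) : ℂ)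

open scoped ComplexOrder in
/-- The class `Υ_{2q}`: continuous functions `φ` on the closed unit disk (values elsewhere play no
role) with `φ(1) = 1` for which `(z, w) ↦ φ(z · w)`, `z · w = ∑ z_k conj w_k`, is positive definite
on the unit sphere of `ℂ^q`. In Mathlib's convention `z · w` is `inner ℂ w z`; `0 ≤ s` for a complex
number `s` means that `s` is real and nonnegative. -/
structure MemUpsilon (q : ℕ) (φ : ℂ → ℂ) : Prop where
  continuousOn : ContinuousOn φ (Metric.closedBall 0 1)
  map_one : φ 1 = 1
  posDef : ∀ (N : ℕ) (z : Fin N → EuclideanSpace ℂ (Fin q)), Function.Injective z →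
    (∀ i, ‖z i‖ = 1) → ∀ c : Fin N → ℂ,
      0 ≤ ∑ i, ∑ j, c i * conj (c j) * φ (inner ℂ (z j) (z i))

/-- `(φ, a)` is a `2q`-Schoenberg pair (for `q ≥ 2`): `φ` belongs to `Υ_{2q}`, `a` is a probability
mass function on pairs of nonnegative integers, and `φ = ∑ a_{m,n} R^{q-2}_{m,n}` on the closed unit
disk. -/
structure IsSchoenbergPair (q : ℕ) (φ : ℂ → ℂ) (a : ℕ → ℕ → ℝ) : Prop where
  memUpsilon : MemUpsilon q φ
  nonneg : ∀ m n, 0 ≤ a m n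
  hasSum_one : HasSum (fun p : ℕ × ℕ => a p.1 p.2) 1
  expansion : ∀ z ∈ Metric.closedBall (0 : ℂ) 1,
    HasSum (fun p : ℕ × ℕ => (a p.1 p.2 : ℂ) * diskPoly (q - 2) p.1 p.2 z) (φ z)

/-- The rising factorial `x (x+1) ⋯ (x+j-1)`. -/
noncomputable def rising (x : ℝ) (j : ℕ) : ℝ := (ascPochhammer ℝ j).eval x

/-- The weights `v^{q-2}_{j,m,n}`, for `q ≥ 2` and `m ≥ 1`. -/
noncomputable def weight (q j m n : ℕ) : ℝ :=
  ((q : ℝ) - 1) * ((m : ℝ) + n + q - 2) * rising m j * rising ((n : ℝ) + 1) j /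
    (rising ((m : ℝ) + q - 2) (j + 1) * rising ((n : ℝ) + q - 1) (j + 1))

end ComplexSphere

namespace ComplexSphere

/-! Write α = q - 2. The connection formula `diskPoly_succ_eq_sum_weight` expands R^{α+1}_{M,N} in
the R^α_{M-j,N-j} with positive weights, and evaluation at z = 1 shows that these weights sum to
one. Inserting it into the given expansion of φ and regrouping along (m, n) = (M - j, N - j)
produces the series for the new coefficients; they are nonnegative and their total mass is still 1.
The regrouping is legitimate because |R^α_{m,n}| ≤ 1 on the disk (`norm_diskPoly_le_one`). Positive
definiteness is inherited because the sphere of ℂ^q sits inside that of ℂ^{q+1}.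

Uniqueness and the integral formula come from orthogonality (`integral_diskPoly_mul_conj`): by the
same bound a summable expansion can be integrated term by term, so its coefficients are Fourier
coefficients (`eq_diskCoeff_of_hasSum`).

The bound itself is proved for α = 0, where the R^0_{m,n} are matrix coefficients of SU(2), and
passes to every α because the connection formula is a convex combination. -/

/-! ### Disk polynomials and the connection formula from α + 1 to α. -/

theorem diskPoly_eq_sum_range (α m n : ℕ) (z : ℂ) {K : ℕ} (hK : min m n < K) :
    diskPoly α m n z = ∑ j ∈ Finset.range K,
      (-1 : ℂ) ^ j * ((m.choose j : ℂ) * (n.choose j : ℂ) / ((α + j).choose j : ℂ)) *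
        z ^ (m - j) * conj z ^ (n - j) * (1 - (‖z‖ : ℂ) ^ 2) ^ j := by
  unfold diskPoly
  refine Finset.sum_subset (Finset.range_mono hK) fun j _ hj => ?_
  have hj' : min m n < j := by
    rw [Finset.mem_range] at hj
    omega
  rcases min_lt_iff.1 hj' with h | h <;> simp [Nat.choose_eq_zero_of_lt h]

theorem diskPoly_of_min_eq_zero (α : ℕ) {m n : ℕ} (h : min m n = 0) (z : ℂ) :
    diskPoly α m n z = z ^ m * conj z ^ n := by
  simp [diskPoly, h]

theorem diskPoly_one (α m n : ℕ) : diskPoly α m n 1 = 1 := by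
  simp only [diskPoly]
  rw [Finset.sum_eq_single 0]
  · simp
  · intro j _ hj
    simp [hj]
  · simp

theorem diskPoly_conj_symm (α m n : ℕ) (z : ℂ) :
    conj (diskPoly α m n z) = diskPoly α n m z := by
  simp only [diskPoly, map_sum, map_mul, map_pow, map_sub, map_one, map_neg, map_div₀,
    Complex.conj_conj, Complex.conj_ofReal, map_natCast, min_comm m n]
  refine Finset.sum_congr rfl fun j _ => ?_
  ring

theorem continuous_diskPoly (α m n : ℕ) : Continuous (diskPoly α m n) := by
  unfold diskPoly
  have : Continuous fun z : ℂ => conj z := Complex.continuous_conj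
  fun_prop

/-- With s = 1 - |z|², all three terms can be written in the monomials z^(M+1-j) z̄^(N+1-j) s^j; the
identity then holds coefficient by coefficient. -/
theorem diskPoly_recurrence (α M N : ℕ) (z : ℂ) :
    ((M : ℂ) + α + 2) * (N + α + 2) * diskPoly (α + 1) (M + 1) (N + 1) z =
      (M + 1) * (N + 1) * diskPoly (α + 1) M N z +
        (α + 1) * (M + N + α + 3) * diskPoly α (M + 1) (N + 1) z := by
  set K := min M N + 1 with hK
  have hmin : min (M + 1) (N + 1) < K + 1 := by omega
  rw [diskPoly_eq_sum_range _ _ _ _ hmin, diskPoly_eq_sum_range _ _ _ _ hmin]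
  set s : ℂ := 1 - (‖z‖ : ℂ) ^ 2 with hs
  have hone : z * conj z + s = 1 := by
    rw [Complex.mul_conj']; ring
  -- Multiplication by 1 = z z̄ + s raises the bidegree to (M+1, N+1). The term j = K of the first
  -- sum is zero; it is kept to match the other ranges.
  have hR : diskPoly (α + 1) M N z = ∑ j ∈ Finset.range (K + 1),
      (-1 : ℂ) ^ j * ((M.choose j : ℂ) * (N.choose j : ℂ) / ((α + 1 + j).choose j : ℂ)) *
        z ^ (M + 1 - j) * conj z ^ (N + 1 - j) * s ^ j +
      ∑ j ∈ Finset.range K,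
      (-1 : ℂ) ^ j * ((M.choose j : ℂ) * (N.choose j : ℂ) / ((α + 1 + j).choose j : ℂ)) *
        z ^ (M - j) * conj z ^ (N - j) * s ^ (j + 1) := by
    have hz : ((M.choose K : ℂ) * (N.choose K : ℂ)) = 0 := by
      rcases min_choice M N with h | h <;> simp [hK, h]
    rw [Finset.sum_range_succ, hz]
    simp only [zero_div, mul_zero, zero_mul, add_zero]
    rw [diskPoly_eq_sum_range _ _ _ _ (Nat.lt_succ_self _), ← Finset.sum_add_distrib]
    refine Finset.sum_congr rfl fun j hj => ?_
    have hj' : j ≤ min M N := Nat.lt_succ_iff.1 (Finset.mem_range.1 hj)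
    rw [Nat.sub_add_comm (hj'.trans (min_le_left _ _)),
      Nat.sub_add_comm (hj'.trans (min_le_right _ _))]
    rw [← hs]
    linear_combination (-((-1 : ℂ) ^ j *
      ((M.choose j : ℂ) * (N.choose j : ℂ) / ((α + 1 + j).choose j : ℂ)) *
        z ^ (M - j) * conj z ^ (N - j) * s ^ j)) * hone
  -- Reindexing j + 1 as j; the factors j kill the added term j = 0, so the truncated j - 1 is
  -- harmless there.
  have hshift : ∑ j ∈ Finset.range K,
      (-1 : ℂ) ^ j * ((M.choose j : ℂ) * (N.choose j : ℂ) / ((α + 1 + j).choose j : ℂ)) *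
        z ^ (M - j) * conj z ^ (N - j) * s ^ (j + 1) =
      ∑ j ∈ Finset.range (K + 1),
        (-1 : ℂ) ^ j * (-((((M + 1).choose j : ℂ) * j / (M + 1)) *
          (((N + 1).choose j : ℂ) * j / (N + 1)) / ((α + j).choose (j - 1) : ℂ))) *
        z ^ (M + 1 - j) * conj z ^ (N + 1 - j) * s ^ j := by
    rw [Finset.sum_range_succ' _ K]
    simp only [Nat.cast_zero, mul_zero, zero_div, neg_zero, zero_mul, add_zero]
    refine Finset.sum_congr rfl fun j _ => ?_
    have h1 : ((M + 1).choose (j + 1) : ℂ) * (j + 1) / (M + 1) = M.choose j := by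
      rw [div_eq_iff (by exact_mod_cast Nat.succ_ne_zero M)]
      exact_mod_cast (((Nat.add_one_mul_choose_eq M j).symm).trans (mul_comm _ _))
    have h2 : ((N + 1).choose (j + 1) : ℂ) * (j + 1) / (N + 1) = N.choose j := by
      rw [div_eq_iff (by exact_mod_cast Nat.succ_ne_zero N)]
      exact_mod_cast (((Nat.add_one_mul_choose_eq N j).symm).trans (mul_comm _ _))
    push_cast
    rw [h1, h2, show α + (j + 1) = α + 1 + j by ring]
    ring
  rw [hR, hshift, ← Finset.sum_add_distrib]
  simp only [Finset.mul_sum]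
  rw [← Finset.sum_add_distrib]
  refine Finset.sum_congr rfl fun j hj => ?_
  have hj' : j ≤ min M N + 1 := by
    have := Finset.mem_range.1 hj
    omega
  have hα : (α : ℂ) + 1 ≠ 0 := by exact_mod_cast Nat.succ_ne_zero α
  have hαj : (α : ℂ) + 1 + j ≠ 0 := by
    have : ((α + 1 + j : ℕ) : ℂ) ≠ 0 := Nat.cast_ne_zero.2 (by omega)
    exact_mod_cast this
  have hM : (M : ℂ) + 1 ≠ 0 := by exact_mod_cast Nat.succ_ne_zero M
  have hN : (N : ℂ) + 1 ≠ 0 := by exact_mod_cast Nat.succ_ne_zero N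
  have hc : ((α + j).choose j : ℂ) ≠ 0 :=
    Nat.cast_ne_zero.2 (Nat.choose_pos (Nat.le_add_left _ _)).ne'
  have hMj : (M.choose j : ℂ) = (M + 1).choose j * (M + 1 - j) / (M + 1) := by
    rw [eq_div_iff hM]
    have := Nat.choose_mul_succ_eq M j
    rw [← Nat.cast_inj (R := ℂ)] at this
    rw [Nat.cast_mul, Nat.cast_mul, Nat.cast_sub (by omega)] at this
    exact_mod_cast this
  have hNj : (N.choose j : ℂ) = (N + 1).choose j * (N + 1 - j) / (N + 1) := by
    rw [eq_div_iff hN]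
    have := Nat.choose_mul_succ_eq N j
    rw [← Nat.cast_inj (R := ℂ)] at this
    rw [Nat.cast_mul, Nat.cast_mul, Nat.cast_sub (by omega)] at this
    exact_mod_cast this
  have hc1 : ((α + 1 + j).choose j : ℂ) = (α + j).choose j * (α + 1 + j) / (α + 1) := by
    rw [eq_div_iff hα]
    have := Nat.choose_mul_succ_eq (α + j) j
    rw [show α + j + 1 - j = α + 1 by omega, show α + j + 1 = α + 1 + j by ring] at this
    exact_mod_cast this.symm
  have hc2 : (j : ℂ) * j / ((α + j).choose (j - 1) : ℂ) =
      j * (α + 1) / ((α + j).choose j : ℂ) := by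
    rcases j with _ | j
    · simp
    · have hc3 : ((α + (j + 1)).choose j : ℂ) ≠ 0 :=
        Nat.cast_ne_zero.2 (Nat.choose_pos (by omega)).ne'
      have := Nat.choose_succ_right_eq (α + (j + 1)) j
      rw [show α + (j + 1) - j = α + 1 by omega, ← Nat.cast_inj (R := ℂ)] at this
      push_cast at this
      rw [Nat.add_sub_cancel, div_eq_div_iff hc3 hc]
      push_cast
      linear_combination ((j : ℂ) + 1) * this
  have hc2' : (((M + 1).choose j : ℂ) * j / (M + 1)) *
          (((N + 1).choose j : ℂ) * j / (N + 1)) / ((α + j).choose (j - 1) : ℂ) =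
      ((M + 1).choose j : ℂ) / (M + 1) * ((N + 1).choose j / (N + 1)) *
        (j * (α + 1) / ((α + j).choose j : ℂ)) := by
    rw [← hc2]; ring
  rw [hc2', hMj, hNj, hc1]
  field_simp
  ring

theorem diskNormConst_pos (α m n : ℕ) : 0 < diskNormConst α m n := by
  unfold diskNormConst
  have h1 : 0 < (m + α).choose α := Nat.choose_pos (Nat.le_add_left _ _)
  have h2 : 0 < (n + α).choose α := Nat.choose_pos (Nat.le_add_left _ _)
  positivity

theorem choose_add_succ_eq (α m : ℕ) :
    ((m + (α + 1)).choose (α + 1) : ℂ) = (m + α + 1) / (α + 1) * (m + α).choose α := by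
  have hα : (α : ℂ) + 1 ≠ 0 := by exact_mod_cast Nat.succ_ne_zero α
  have := Nat.add_one_mul_choose_eq (m + α) α
  rw [← Nat.cast_inj (R := ℂ)] at this
  push_cast at this
  rw [div_mul_eq_mul_div, eq_div_iff hα, ← add_assoc, this]

theorem choose_add_succ_eq' (α m : ℕ) :
    ((m + (α + 1)).choose (α + 1) : ℂ) = (m + 1) / (α + 1) * (m + 1 + α).choose α := by
  have hα : (α : ℂ) + 1 ≠ 0 := by exact_mod_cast Nat.succ_ne_zero α
  have := Nat.choose_succ_right_eq (m + (α + 1)) α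
  rw [show m + (α + 1) - α = m + 1 by omega, ← Nat.cast_inj (R := ℂ)] at this
  push_cast at this
  rw [div_mul_eq_mul_div, eq_div_iff hα, this, show m + 1 + α = m + (α + 1) by ring]
  ring

/-- Expansion of the disk polynomials of parameter `α + 1` in those of parameter `α`. -/
theorem choose_mul_diskPoly_succ (α M N : ℕ) (z : ℂ) :
    ((M + (α + 1)).choose (α + 1) : ℂ) * (N + (α + 1)).choose (α + 1) *
        diskPoly (α + 1) M N z =
      ∑ j ∈ Finset.range (min M N + 1),
        (diskNormConst α (M - j) (N - j) : ℂ) * diskPoly α (M - j) (N - j) z := by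
  have hα : (α : ℂ) + 1 ≠ 0 := by exact_mod_cast Nat.succ_ne_zero α
  have key : ∀ M N : ℕ, min M N = 0 →
      ((M + (α + 1)).choose (α + 1) : ℂ) * (N + (α + 1)).choose (α + 1) *
        diskPoly (α + 1) M N z =
      ∑ j ∈ Finset.range (min M N + 1),
        (diskNormConst α (M - j) (N - j) : ℂ) * diskPoly α (M - j) (N - j) z := by
    intro M N h
    have hMN : (M : ℂ) * N = 0 := by
      rcases Nat.min_eq_zero_iff.1 h with rfl | rfl <;> simp
    rw [h, zero_add, Finset.sum_range_one, Nat.sub_zero, Nat.sub_zero,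
      diskPoly_of_min_eq_zero _ h, diskPoly_of_min_eq_zero _ h, choose_add_succ_eq,
      choose_add_succ_eq, diskNormConst]
    push_cast
    field_simp
    linear_combination ((M + α).choose α : ℂ) * (N + α).choose α * z ^ M * conj z ^ N * hMN
  induction M generalizing N with
  | zero => exact key _ _ (by simp)
  | succ M ih =>
    rcases N with _ | N
    · exact key _ _ (by simp)
    · rw [Nat.add_min_add_right, Finset.sum_range_succ']
      simp only [Nat.add_sub_add_right, Nat.sub_zero]
      -- The terms after the leading one form the expansion for (M, N). Every binomial is reduced to
      -- C(M+1+α, α) or C(N+1+α, α), so that only the recurrence remains.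
      rw [← ih, choose_add_succ_eq' α M, choose_add_succ_eq' α N, choose_add_succ_eq α (M + 1),
        choose_add_succ_eq α (N + 1), diskNormConst]
      push_cast
      field_simp
      linear_combination ((M + 1 + α).choose α : ℂ) * (N + 1 + α).choose α *
        diskPoly_recurrence α M N z

theorem rising_natCast_succ (k j : ℕ) :
    rising ((k : ℝ) + 1) j = ((k + j).factorial : ℝ) / k.factorial := by
  rw [eq_div_iff (by positivity), rising]
  have h := Nat.factorial_mul_ascFactorial k j
  have h2 := ascPochhammer_nat_eq_ascFactorial (k + 1) j
  have h3 := ascPochhammer_eval_cast (S := ℝ) j (k + 1)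
  rw [h2] at h3
  push_cast at h3
  rw [← h3, ← h]
  push_cast
  ring

theorem cast_choose_add (α m : ℕ) :
    ((m + α).choose α : ℝ) = (m + α).factorial / (m.factorial * α.factorial) := by
  rw [← Nat.choose_symm_add, Nat.cast_add_choose]

/-- In this form the weight is the coefficient in the connection formula, and its positivity is
visible. -/
theorem weight_eq (α j m n : ℕ) :
    weight (α + 2) j (m + 1) n = diskNormConst α m n /
      (((m + j + (α + 1)).choose (α + 1) : ℝ) * (n + j + (α + 1)).choose (α + 1)) := by
  unfold weight diskNormConst
  have e1 : (((m + 1 : ℕ) : ℝ) + ((α + 2 : ℕ) : ℝ) - 2) = ((m + α : ℕ) : ℝ) + 1 := by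
    push_cast; ring
  have e2 : ((n : ℝ) + ((α + 2 : ℕ) : ℝ) - 1) = ((n + α : ℕ) : ℝ) + 1 := by push_cast; ring
  rw [e1, e2, Nat.cast_succ m, rising_natCast_succ, rising_natCast_succ, rising_natCast_succ,
    rising_natCast_succ, cast_choose_add, cast_choose_add, cast_choose_add, cast_choose_add, show m + α + (j + 1) = m + j + (α + 1) by ring,
    show n + α + (j + 1) = n + j + (α + 1) by ring, Nat.factorial_succ α]
  push_cast
  field_simp
  ring

theorem weight_pos (α j m n : ℕ) : 0 < weight (α + 2) j (m + 1) n := by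
  rw [weight_eq]
  have h1 : 0 < (m + j + (α + 1)).choose (α + 1) := Nat.choose_pos (Nat.le_add_left _ _)
  have h2 : 0 < (n + j + (α + 1)).choose (α + 1) := Nat.choose_pos (Nat.le_add_left _ _)
  have := diskNormConst_pos α m n
  positivity

theorem diskPoly_succ_eq_sum_weight (α M N : ℕ) (z : ℂ) :
    diskPoly (α + 1) M N z = ∑ j ∈ Finset.range (min M N + 1),
      (weight (α + 2) j (M - j + 1) (N - j) : ℂ) * diskPoly α (M - j) (N - j) z := by
  have h1 : ((M + (α + 1)).choose (α + 1) : ℂ) ≠ 0 :=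
    Nat.cast_ne_zero.2 (Nat.choose_pos (Nat.le_add_left _ _)).ne'
  have h2 : ((N + (α + 1)).choose (α + 1) : ℂ) ≠ 0 :=
    Nat.cast_ne_zero.2 (Nat.choose_pos (Nat.le_add_left _ _)).ne'
  refine mul_left_cancel₀ (mul_ne_zero h1 h2) ?_
  rw [choose_mul_diskPoly_succ, Finset.mul_sum]
  refine Finset.sum_congr rfl fun j hj => ?_
  have hj' := Finset.mem_range.1 hj
  rw [weight_eq, Nat.sub_add_cancel (by omega), Nat.sub_add_cancel (by omega)]
  push_cast
  field_simp

theorem sum_weight_eq_one (α M N : ℕ) :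
    ∑ j ∈ Finset.range (min M N + 1), weight (α + 2) j (M - j + 1) (N - j) = 1 := by
  have h := diskPoly_succ_eq_sum_weight α M N 1
  simp only [diskPoly_one, mul_one] at h
  exact_mod_cast h.symm

/-! ### The bound |R^α_{m,n}| ≤ 1 on the disk. -/

open Polynomial in
theorem norm_coeff_le_of_norm_eval_le (p : ℂ[X]) {C : ℝ} (h : ∀ x : ℂ, ‖x‖ = 1 → ‖p.eval x‖ ≤ C)
    (k : ℕ) : ‖p.coeff k‖ ≤ C := by
  have hd : DiffContOnCl ℂ (fun x => p.eval x) (Metric.ball 0 1) :=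
    p.differentiable.diffContOnCl
  have := Complex.norm_iteratedDeriv_le_of_forall_mem_sphere_norm_le k one_pos hd
    (C := C) (fun x hx => h x (by simpa using hx))
  have hiter : ∀ i : ℕ, deriv^[i] (fun x => p.eval x) = fun x => (derivative^[i] p).eval x := by
    intro i
    induction i with
    | zero => rfl
    | succ i ih =>
      rw [Function.iterate_succ_apply', ih, Function.iterate_succ_apply']
      exact funext fun x => Polynomial.deriv _
  rw [iteratedDeriv_eq_iterate, hiter] at this
  beta_reduce at this
  rw [← Polynomial.coeff_zero_eq_eval_zero,
    Polynomial.coeff_iterate_derivative] at this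
  simp only [zero_add, Nat.descFactorial_self, nsmul_eq_mul, norm_mul, one_pow, div_one,
    RCLike.norm_natCast] at this
  exact le_of_mul_le_mul_left this (by positivity)

/-- Weighted AM-GM: 1 + x ≤ e^x gives W ≤ k e^{W/k - 1}, and the exponentials cancel in the product.
-/
theorem pow_mul_pow_le_of_add_eq {m n : ℕ} (hm : m ≠ 0) (hn : n ≠ 0) {U V : ℝ} (hU : 0 ≤ U)
    (hV : 0 ≤ V) (h : U + V = m + n) : U ^ m * V ^ n ≤ (m : ℝ) ^ m * (n : ℝ) ^ n := by
  have key : ∀ (k : ℕ) (W : ℝ), k ≠ 0 → 0 ≤ W → W ^ k ≤ (k : ℝ) ^ k * Real.exp (W - k) := by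
    intro k W hk hW
    have hk' : (0 : ℝ) < k := Nat.cast_pos.2 (Nat.pos_of_ne_zero hk)
    have h1 : W ≤ k * Real.exp (W / k - 1) := by
      have := Real.add_one_le_exp (W / k - 1)
      rw [sub_add_cancel, div_le_iff₀ hk'] at this
      linarith
    calc W ^ k ≤ (k * Real.exp (W / k - 1)) ^ k := pow_le_pow_left₀ hW h1 k
      _ = (k : ℝ) ^ k * Real.exp (W - k) := by
        rw [mul_pow, ← Real.exp_nat_mul, mul_sub, mul_div_cancel₀ _ hk'.ne', mul_one]
  calc U ^ m * V ^ n ≤ ((m : ℝ) ^ m * Real.exp (U - m)) * ((n : ℝ) ^ n * Real.exp (V - n)) :=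
        mul_le_mul (key m U hm hU) (key n V hn hV) (by positivity) (by positivity)
    _ = (m : ℝ) ^ m * (n : ℝ) ^ n * Real.exp (U - m + (V - n)) := by rw [Real.exp_add]; ring
    _ = _ := by rw [show U - m + (V - n) = 0 by linarith, Real.exp_zero, mul_one]

open Polynomial in
/-- The disk polynomials with `α = 0` are diagonal matrix coefficients of the representation of
`SU(2)` on binary forms. -/
theorem coeff_mul_pow_eq_diskPoly_zero (m n : ℕ) (z w a b : ℂ) (hw : w ^ 2 = 1 - (‖z‖ : ℂ) ^ 2) :
    ((C (z * a) * X + C (-(w * b))) ^ m * (C (w * a) * X + C (conj z * b)) ^ n).coeff m =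
      a ^ m * b ^ n * diskPoly 0 m n z := by
  have hcoeff : ∀ (u v : ℂ) (k i : ℕ),
      ((C u * X + C v) ^ k).coeff i = v ^ (k - i) * (k.choose i : ℂ) * u ^ i := by
    intro u v k i
    have : (C u * X + C v) ^ k = ((X + C v) ^ k).comp (C u * X) := by simp
    rw [this, comp_C_mul_X_coeff, coeff_X_add_C_pow]
  rw [coeff_mul, Finset.Nat.sum_antidiagonal_eq_sum_range_succ_mk,
    diskPoly_eq_sum_range 0 m n z (show min m n < m + 1 by omega), Finset.mul_sum,
    -- After reversal, index j means that m - j factors X come from the first power and j from the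
    -- second.
    ← Finset.sum_range_reflect]
  refine Finset.sum_congr rfl fun j hj => ?_
  have hj' : j ≤ m := Nat.lt_succ_iff.1 (Finset.mem_range.1 hj)
  rw [hcoeff, hcoeff, show m + 1 - 1 - j = m - j by omega, Nat.sub_sub_self hj',
    Nat.choose_symm hj', ← hw]
  by_cases hjn : j ≤ n
  · have ha : a ^ m = a ^ (m - j) * a ^ j := by rw [← pow_add, Nat.sub_add_cancel hj']
    have hb : b ^ n = b ^ (n - j) * b ^ j := by rw [← pow_add, Nat.sub_add_cancel hjn]
    rw [ha, hb, zero_add, Nat.choose_self, neg_pow (w * b)]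
    simp only [mul_pow, Nat.cast_one, div_one, ← pow_mul]
    ring
  · simp [Nat.choose_eq_zero_of_lt (not_le.1 hjn)]

/-- Cauchy's estimate for the coefficient of X^m on |x| = 1. The two linear forms are a unitary
matrix applied to (ax, b), so their squared moduli add up to a² + b². With a = √m and b = √n, AM-GM
bounds the product by exactly a^m b^n, which is the factor to be cancelled. -/
theorem norm_diskPoly_zero_le_one (m n : ℕ) {z : ℂ} (hz : ‖z‖ ≤ 1) : ‖diskPoly 0 m n z‖ ≤ 1 := by
  rcases Nat.eq_zero_or_pos m with rfl | hm
  · rw [diskPoly_of_min_eq_zero _ (by simp)]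
    simpa using pow_le_one₀ (norm_nonneg z) hz
  rcases Nat.eq_zero_or_pos n with rfl | hn
  · rw [diskPoly_of_min_eq_zero _ (by simp)]
    simpa using pow_le_one₀ (norm_nonneg z) hz
  have hz2 : 0 ≤ 1 - ‖z‖ ^ 2 := by nlinarith [norm_nonneg z]
  set w : ℝ := √(1 - ‖z‖ ^ 2)
  have hw : w ^ 2 = 1 - ‖z‖ ^ 2 := Real.sq_sqrt hz2
  set a : ℝ := √m
  set b : ℝ := √n
  have ha : a ^ 2 = m := Real.sq_sqrt (Nat.cast_nonneg m)
  have hb : b ^ 2 = n := Real.sq_sqrt (Nat.cast_nonneg n)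
  have ha0 : 0 < a := Real.sqrt_pos.2 (Nat.cast_pos.2 hm)
  have hb0 : 0 < b := Real.sqrt_pos.2 (Nat.cast_pos.2 hn)
  have hcoeff := coeff_mul_pow_eq_diskPoly_zero m n z w a b (by exact_mod_cast hw)
  have hle := norm_coeff_le_of_norm_eval_le
    ((Polynomial.C (z * a) * Polynomial.X + Polynomial.C (-(w * b : ℂ))) ^ m *
      (Polynomial.C (w * a : ℂ) * Polynomial.X + Polynomial.C (conj z * b)) ^ n)
    (C := a ^ m * b ^ n) ?_ m
  · rw [hcoeff] at hle
    simp only [norm_mul, norm_pow, Complex.norm_real, Real.norm_of_nonneg ha0.le,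
      Real.norm_of_nonneg hb0.le] at hle
    exact le_of_mul_le_mul_left (hle.trans_eq (mul_one _).symm) (by positivity)
  · intro x hx
    simp only [Polynomial.eval_mul, Polynomial.eval_pow, Polynomial.eval_add, Polynomial.eval_C,
      Polynomial.eval_X, norm_mul, norm_pow]
    refine le_of_sq_le_sq ?_ (by positivity)
    have hsum : ‖z * a * x + -(w * b)‖ ^ 2 + ‖w * a * x + conj z * b‖ ^ 2 = m + n := by
      rw [← ha, ← hb]
      apply Complex.ofReal_injective
      have hx2 : x * conj x = 1 := by rw [Complex.mul_conj', hx]; simp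
      have hz2 : z * conj z + (w : ℂ) ^ 2 = 1 := by
        rw [Complex.mul_conj', ← Complex.ofReal_pow w, hw]; push_cast; ring
      push_cast
      rw [← Complex.mul_conj', ← Complex.mul_conj']
      simp only [map_add, map_mul, map_neg, Complex.conj_conj, Complex.conj_ofReal]
      linear_combination (z * conj z + (w : ℂ) ^ 2) * (a : ℂ) ^ 2 * hx2 +
        ((a : ℂ) ^ 2 + (b : ℂ) ^ 2) * hz2
    calc (‖z * a * x + -(w * b)‖ ^ m * ‖w * a * x + conj z * b‖ ^ n) ^ 2
        = (‖z * a * x + -(w * b)‖ ^ 2) ^ m * (‖w * a * x + conj z * b‖ ^ 2) ^ n := by ring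
      _ ≤ (m : ℝ) ^ m * (n : ℝ) ^ n :=
        pow_mul_pow_le_of_add_eq hm.ne' hn.ne' (by positivity) (by positivity) hsum
      _ = (a ^ m * b ^ n) ^ 2 := by rw [← ha, ← hb]; ring

/-- A convex combination of disk polynomials of the preceding parameter. -/
theorem norm_diskPoly_le_one (α m n : ℕ) {z : ℂ} (hz : ‖z‖ ≤ 1) : ‖diskPoly α m n z‖ ≤ 1 := by
  induction α generalizing m n with
  | zero => exact norm_diskPoly_zero_le_one m n hz
  | succ α ih =>
    rw [diskPoly_succ_eq_sum_weight, ← sum_weight_eq_one α m n]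
    refine norm_sum_le_of_le _ fun j _ => ?_
    rw [norm_mul, Complex.norm_real, Real.norm_of_nonneg (weight_pos _ _ _ _).le]
    exact mul_le_of_le_one_right (weight_pos _ _ _ _).le (ih _ _)

/-! ### Orthogonality on the disk. -/

theorem integral_pow_mul_one_sub_pow (a c : ℕ) :
    ∫ t in (0 : ℝ)..1, t ^ a * (1 - t) ^ c =
      (a.factorial : ℝ) * c.factorial / (a + c + 1).factorial := by
  induction c generalizing a with
  | zero =>
    simp only [pow_zero, mul_one, integral_pow]
    rw [add_zero, Nat.factorial_succ]
    have : (a.factorial : ℝ) ≠ 0 := by positivity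
    push_cast
    field_simp
    simp
  | succ c ih =>
    -- Integration by parts: this function vanishes at both endpoints, which trades a power of 1 - t
    -- for a power of t.
    have hderiv : ∀ t ∈ Set.uIcc (0 : ℝ) 1, HasDerivAt (fun t : ℝ => t ^ (a + 1) * (1 - t) ^ (c + 1))
        (((a : ℝ) + 1) * (t ^ a * (1 - t) ^ (c + 1)) -
          ((c : ℝ) + 1) * (t ^ (a + 1) * (1 - t) ^ c)) t := by
      intro t _
      have h1 := hasDerivAt_pow (a + 1) t
      have h2 := (((hasDerivAt_id t).const_sub 1).pow (c + 1))
      refine (h1.mul h2).congr_deriv ?_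
      simp
      ring
    have hint : ∀ i j : ℕ, IntervalIntegrable (fun t : ℝ => t ^ i * (1 - t) ^ j)
        MeasureTheory.volume 0 1 :=
      fun i j => Continuous.intervalIntegrable (by fun_prop) _ _
    have h := intervalIntegral.integral_eq_sub_of_hasDerivAt hderiv
      (((hint _ _).const_mul _).sub ((hint _ _).const_mul _))
    rw [intervalIntegral.integral_sub ((hint _ _).const_mul _) ((hint _ _).const_mul _),
      intervalIntegral.integral_const_mul, intervalIntegral.integral_const_mul, ih (a + 1)] at h
    simp only [one_pow, sub_self, ne_eq, Nat.add_eq_zero_iff, one_ne_zero, and_false,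
      not_false_eq_true, zero_pow, mul_zero, zero_mul] at h
    rw [show a + 1 + c + 1 = a + (c + 1) + 1 by ring, sub_eq_zero, Nat.factorial_succ a] at h
    have ha : (a : ℝ) + 1 ≠ 0 := by positivity
    refine mul_left_cancel₀ ha (h.trans ?_)
    rw [Nat.factorial_succ c]
    push_cast
    ring

theorem integral_closedBall_norm_sq_pow (a c : ℕ) :
    ∫ z in Metric.closedBall (0 : ℂ) 1, (‖z‖ ^ 2) ^ a * (1 - ‖z‖ ^ 2) ^ c =
      Real.pi * ((a.factorial : ℝ) * c.factorial / (a + c + 1).factorial) := by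
  have h1 : ∫ z in Metric.closedBall (0 : ℂ) 1, (‖z‖ ^ 2) ^ a * (1 - ‖z‖ ^ 2) ^ c =
      ∫ z : ℂ, (Set.Iic (1 : ℝ)).indicator
        (fun r => (r ^ 2) ^ a * (1 - r ^ 2) ^ c) ‖z‖ := by
    rw [← MeasureTheory.integral_indicator measurableSet_closedBall]
    refine MeasureTheory.integral_congr_ae (Filter.Eventually.of_forall fun z => ?_)
    simp [Set.indicator]
  have hball : MeasureTheory.volume.real (Metric.ball (0 : ℂ) 1) = Real.pi := by
    simp [MeasureTheory.measureReal_def, Complex.volume_ball]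
  have hfun : ∀ y : ℝ, y ^ (2 - 1) • (Set.Iic (1 : ℝ)).indicator
        (fun r : ℝ => (r ^ 2) ^ a * (1 - r ^ 2) ^ c) y =
      (Set.Iic (1 : ℝ)).indicator (fun r : ℝ => r * ((r ^ 2) ^ a * (1 - r ^ 2) ^ c)) y := by
    intro y
    by_cases hy : y ≤ 1 <;> simp [Set.indicator, hy]
  have hsubst : ∫ r in (0 : ℝ)..1, r * ((r ^ 2) ^ a * (1 - r ^ 2) ^ c) =
      (∫ t in (0 : ℝ)..1, t ^ a * (1 - t) ^ c) / 2 := by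
    have h := intervalIntegral.integral_comp_mul_deriv (a := 0) (b := 1)
      (f := fun r : ℝ => r ^ 2) (f' := fun r => 2 * r) (g := fun t : ℝ => t ^ a * (1 - t) ^ c)
      (fun r _ => by simpa using hasDerivAt_pow 2 r) (by fun_prop) (by fun_prop)
    simp only [Function.comp_apply, one_pow, ne_eq, OfNat.ofNat_ne_zero, not_false_eq_true,
      zero_pow] at h
    rw [← h, ← intervalIntegral.integral_div]
    refine intervalIntegral.integral_congr fun r _ => ?_
    ring
  rw [h1, MeasureTheory.integral_fun_norm_addHaar, Complex.finrank_real_complex, hball]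
  simp only [hfun]
  rw [MeasureTheory.setIntegral_indicator measurableSet_Iic, Set.Ioi_inter_Iic,
    ← intervalIntegral.integral_of_le zero_le_one, hsubst, integral_pow_mul_one_sub_pow]
  simp
  ring

theorem integral_closedBall_norm_sq_pow_complex (a c : ℕ) :
    ∫ z in Metric.closedBall (0 : ℂ) 1, ((‖z‖ : ℂ) ^ 2) ^ a * (1 - (‖z‖ : ℂ) ^ 2) ^ c =
      Real.pi * ((a.factorial : ℂ) * c.factorial / (a + c + 1).factorial) := by
  have := congrArg (fun x : ℝ => (x : ℂ)) (integral_closedBall_norm_sq_pow a c)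
  beta_reduce at this
  rw [← integral_complex_ofReal] at this
  push_cast at this
  exact this

theorem diskPoly_mul_of_norm_eq_one (α m n : ℕ) {u : ℂ} (hu : ‖u‖ = 1) (z : ℂ) :
    diskPoly α m n (u * z) = u ^ m * conj u ^ n * diskPoly α m n z := by
  have huu : u * conj u = 1 := by rw [Complex.mul_conj', hu]; simp
  simp only [diskPoly, Finset.mul_sum]
  refine Finset.sum_congr rfl fun j hj => ?_
  have hj' := Finset.mem_range.1 hj
  have h1 : u ^ m * conj u ^ n = u ^ (m - j) * conj u ^ (n - j) := by
    calc u ^ m * conj u ^ n = u ^ (m - j + j) * conj u ^ (n - j + j) := by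
          rw [Nat.sub_add_cancel (by omega), Nat.sub_add_cancel (by omega)]
      _ = u ^ (m - j) * conj u ^ (n - j) * (u * conj u) ^ j := by ring
      _ = _ := by rw [huu, one_pow, mul_one]
  rw [h1, norm_mul, hu, one_mul, map_mul, mul_pow, mul_pow]
  ring

/-- Rotation by the angle π/(a - b) preserves the disk and its area but changes the sign of f. -/
theorem integral_closedBall_eq_zero_of_rotation {f : ℂ → ℂ} {a b : ℕ} (hab : a ≠ b)
    (hf : ∀ u z : ℂ, ‖u‖ = 1 → f (u * z) = u ^ a * conj u ^ b * f z) :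
    ∫ z in Metric.closedBall (0 : ℂ) 1, f z = 0 := by
  have hd : (a : ℝ) - b ≠ 0 := sub_ne_zero.2 (Nat.cast_injective.ne hab)
  set u : Circle := Circle.exp (Real.pi / ((a : ℝ) - b)) with hu
  have hval : (u : ℂ) ^ a * conj (u : ℂ) ^ b = -1 := by
    rw [hu, Circle.coe_exp, ← Complex.exp_conj, ← Complex.exp_nat_mul, ← Complex.exp_nat_mul,
      ← Complex.exp_add, ← Complex.exp_pi_mul_I]
    congr 1
    have hd' : (a : ℂ) - b ≠ 0 := by exact_mod_cast hd
    simp only [map_mul, Complex.conj_ofReal, Complex.conj_I]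
    push_cast
    field_simp
    ring
  have hpre : (rotation u) ⁻¹' Metric.closedBall (0 : ℂ) 1 = Metric.closedBall 0 1 := by
    ext z
    rw [Set.mem_preimage, mem_closedBall_zero_iff, mem_closedBall_zero_iff,
      LinearIsometryEquiv.norm_map]
  have h := (rotation u).measurePreserving.setIntegral_preimage_emb
    (rotation u).toHomeomorph.measurableEmbedding f (Metric.closedBall (0 : ℂ) 1)
  rw [hpre] at h
  simp only [rotation_apply, hf _ _ (Circle.norm_coe u), hval, neg_one_mul,
    MeasureTheory.integral_neg] at h
  exact self_eq_neg.1 h.symm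

/-- This is the m-th finite difference at y of x ↦ C(x, k), a polynomial of degree k ≤ m. -/
theorem alternating_sum_choose_mul_choose_sub (m k y : ℕ) (hk : k ≤ m) :
    ∑ j ∈ Finset.range (m + 1), (-1 : ℂ) ^ j * m.choose j * ((y + (m - j)).choose k : ℂ) =
      if k = m then 1 else 0 := by
  have h1 : (fwdDiff 1)^[m] (fun x ↦ x.choose k : ℕ → ℤ) y = if k = m then 1 else 0 := by
    split_ifs with h
    · subst h
      have := fwdDiff_iter_choose 0 k
      rw [add_zero] at this
      rw [this]; simp
    · obtain ⟨d, rfl⟩ := Nat.exists_eq_add_of_lt (lt_of_le_of_ne hk h)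
      have := fwdDiff_iter_choose 0 k
      rw [add_zero] at this
      rw [show k + d + 1 = (d + 1) + k by ring, Function.iterate_add_apply, this,
        Function.iterate_succ_apply]
      simp only [Nat.choose_zero_right, Nat.cast_one, fwdDiff_const]
      simp [fwdDiff_iter_eq_sum_shift]
  rw [fwdDiff_iter_eq_sum_shift, ← Finset.sum_range_reflect] at h1
  rw [← Int.cast_inj (α := ℂ)] at h1
  push_cast at h1
  rw [← h1]
  refine Finset.sum_congr rfl fun j hj => ?_
  have hj' : j ≤ m := Nat.lt_succ_iff.1 (Finset.mem_range.1 hj)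
  rw [Nat.sub_sub_self hj', Nat.choose_symm hj']
  simp

theorem integrableOn_closedBall_of_continuous {f : ℂ → ℂ} (hf : Continuous f) :
    MeasureTheory.IntegrableOn f (Metric.closedBall (0 : ℂ) 1) :=
  hf.continuousOn.integrableOn_compact (isCompact_closedBall _ _)

/-- The index condition makes the integrand radial. In the resulting Beta integrals the denominator
(k+n+α+1)! does not depend on j, so an m-th finite difference remains. -/
theorem integral_diskPoly_mul_monomial (α : ℕ) {m n k l : ℕ} (hmn : m ≤ n) (hk : k ≤ m)
    (h : m + l = n + k) :
    ∫ z in Metric.closedBall (0 : ℂ) 1,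
      diskPoly α m n z * (conj z ^ k * z ^ l) * (1 - (‖z‖ : ℂ) ^ 2) ^ α =
      if k = m then (Real.pi : ℂ) * α.factorial * m.factorial * n.factorial /
        (m + n + α + 1).factorial else 0 := by
  have hexp : ∀ z : ℂ, diskPoly α m n z * (conj z ^ k * z ^ l) * (1 - (‖z‖ : ℂ) ^ 2) ^ α =
      ∑ j ∈ Finset.range (m + 1),
        ((-1 : ℂ) ^ j * ((m.choose j : ℂ) * (n.choose j : ℂ) / ((α + j).choose j : ℂ))) *
          (((‖z‖ : ℂ) ^ 2) ^ (n - j + k) * (1 - (‖z‖ : ℂ) ^ 2) ^ (j + α)) := by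
    intro z
    rw [diskPoly_eq_sum_range α m n z (show min m n < m + 1 by omega), Finset.sum_mul,
      Finset.sum_mul]
    refine Finset.sum_congr rfl fun j hj => ?_
    have hj' := Finset.mem_range.1 hj
    have hp : z ^ (m - j) * z ^ l = z ^ (n - j + k) := by
      rw [← pow_add]; congr 1; omega
    rw [← Complex.mul_conj', mul_pow, ← hp, pow_add, pow_add]
    ring
  simp only [hexp]
  rw [MeasureTheory.integral_finsetSum]
  · simp only [MeasureTheory.integral_const_mul, integral_closedBall_norm_sq_pow_complex]
    have hterm : ∀ j ∈ Finset.range (m + 1),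
        (-1 : ℂ) ^ j * ((m.choose j : ℂ) * (n.choose j : ℂ) / ((α + j).choose j : ℂ)) *
          (Real.pi * (((n - j + k).factorial : ℂ) * (j + α).factorial /
            (n - j + k + (j + α) + 1).factorial)) =
        ((Real.pi : ℂ) * α.factorial * k.factorial * n.factorial / (k + n + α + 1).factorial) *
          ((-1 : ℂ) ^ j * m.choose j * (((n + k - m) + (m - j)).choose k : ℂ)) := by
      intro j hj
      have hj' := Finset.mem_range.1 hj
      rw [show n + k - m + (m - j) = n - j + k by omega,
        show n - j + k + (j + α) + 1 = k + n + α + 1 by omega, ← Nat.choose_symm_add (a := n - j),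
        Nat.cast_add_choose, ← Nat.choose_symm_add (a := α), Nat.cast_add_choose,
        Nat.cast_choose ℂ (show j ≤ n by omega), add_comm j α]
      have hf : ∀ i : ℕ, (i.factorial : ℂ) ≠ 0 := fun i =>
        Nat.cast_ne_zero.2 (Nat.factorial_ne_zero i)
      have := hf (n - j)
      have := hf (k + n + α + 1)
      have := hf (α + j)
      have := hf α
      have := hf j
      have := hf k
      field_simp
    rw [Finset.sum_congr rfl hterm, ← Finset.mul_sum,
      alternating_sum_choose_mul_choose_sub m k _ hk]
    split_ifs with hkm
    · subst hkm; simp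
    · simp
  · intro j _
    exact integrableOn_closedBall_of_continuous (by fun_prop)

/-- Replacing a factor |z|² by |z|² - 1 subtracts the same integral for (k-1, l-1), which vanishes
since k - 1 < m. -/
theorem integral_diskPoly_mul_monomial_mul_pow (α i : ℕ) {m n k l : ℕ} (hmn : m ≤ n) (hk : k ≤ m)
    (h : m + l = n + k) (hi : i ≤ k) :
    ∫ z in Metric.closedBall (0 : ℂ) 1,
      diskPoly α m n z * (conj z ^ (k - i) * z ^ (l - i) * ((‖z‖ : ℂ) ^ 2 - 1) ^ i) *
        (1 - (‖z‖ : ℂ) ^ 2) ^ α =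
      if k = m then (Real.pi : ℂ) * α.factorial * m.factorial * n.factorial /
        (m + n + α + 1).factorial else 0 := by
  induction i generalizing k l with
  | zero => simpa using integral_diskPoly_mul_monomial α hmn hk h
  | succ i ih =>
    have h1 := ih hk h (by omega)
    have h2 := ih (k := k - 1) (l := l - 1) (by omega) (by omega) (by omega)
    rw [if_neg (by omega)] at h2
    have hcont : ∀ k l : ℕ, MeasureTheory.IntegrableOn (fun z : ℂ =>
        diskPoly α m n z * (conj z ^ (k - i) * z ^ (l - i) * ((‖z‖ : ℂ) ^ 2 - 1) ^ i) *
        (1 - (‖z‖ : ℂ) ^ 2) ^ α) (Metric.closedBall 0 1) := by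
      intro k l
      refine integrableOn_closedBall_of_continuous ?_
      have := continuous_diskPoly α m n
      have : Continuous fun z : ℂ => conj z := Complex.continuous_conj
      fun_prop
    have h3 := MeasureTheory.integral_sub (hcont k l) (hcont (k - 1) (l - 1))
    rw [h1, h2, sub_zero] at h3
    rw [← h3]
    refine MeasureTheory.integral_congr_ae (Filter.Eventually.of_forall fun z => ?_)
    beta_reduce
    rw [show k - i = k - (i + 1) + 1 by omega, show l - i = l - (i + 1) + 1 by omega,
      show k - 1 - i = k - (i + 1) by omega, show l - 1 - i = l - (i + 1) by omega, pow_succ,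
      pow_succ (conj z), pow_succ z, ← Complex.mul_conj']
    ring

/-- Vandermonde's identity, after C(l, i)/C(α+i, i) is rewritten as C(l+α, l-i)/C(l+α, α). -/
theorem sum_choose_mul_choose_div_choose (α k l : ℕ) :
    ∑ i ∈ Finset.range (l + 1), ((k.choose i : ℂ) * l.choose i / (α + i).choose i) =
      (k + (l + α)).choose l / (l + α).choose α := by
  rw [Nat.add_choose_eq, Finset.Nat.sum_antidiagonal_eq_sum_range_succ_mk]
  push_cast
  rw [Finset.sum_div]
  refine Finset.sum_congr rfl fun i hi => ?_
  have hi' : i ≤ l := Nat.lt_succ_iff.1 (Finset.mem_range.1 hi)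
  have h1 : ((l + α).choose (l - i) : ℂ) = (l + α).factorial /
      ((l - i).factorial * (α + i).factorial) := by
    rw [Nat.cast_choose ℂ (show l - i ≤ l + α by omega), show l + α - (l - i) = α + i by omega]
  rw [h1, ← Nat.choose_symm_add (a := α), Nat.cast_add_choose, ← Nat.choose_symm_add (a := l),
    Nat.cast_add_choose, Nat.cast_choose ℂ hi']
  have hf : ∀ i : ℕ, (i.factorial : ℂ) ≠ 0 := fun i =>
    Nat.cast_ne_zero.2 (Nat.factorial_ne_zero i)
  have := hf (l - i)
  have := hf (α + i)
  have := hf (l + α)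
  have := hf α
  have := hf i
  have := hf l
  field_simp

/-- Once the signs are absorbed into (|z|² - 1)^i, all terms of the conjugated polynomial contribute
the same integral, weighted by the coefficients that Vandermonde sums. -/
theorem integral_diskPoly_mul_conj_of_le (α : ℕ) {m n k l : ℕ} (hmn : m ≤ n) (hk : k ≤ m)
    (h : m + l = n + k) :
    ∫ z in Metric.closedBall (0 : ℂ) 1,
      diskPoly α m n z * conj (diskPoly α k l z) * (1 - (‖z‖ : ℂ) ^ 2) ^ α =
      if k = m then (Real.pi : ℂ) / ((α + 1) * diskNormConst α m n) else 0 := by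
  have hexp : ∀ z : ℂ, diskPoly α m n z * conj (diskPoly α k l z) * (1 - (‖z‖ : ℂ) ^ 2) ^ α =
      ∑ i ∈ Finset.range (k + 1), ((k.choose i : ℂ) * l.choose i / (α + i).choose i) *
        (diskPoly α m n z * (conj z ^ (k - i) * z ^ (l - i) * ((‖z‖ : ℂ) ^ 2 - 1) ^ i) *
        (1 - (‖z‖ : ℂ) ^ 2) ^ α) := by
    intro z
    rw [diskPoly_conj_symm, diskPoly_eq_sum_range α l k z (show min l k < k + 1 by omega),
      Finset.mul_sum, Finset.sum_mul]
    refine Finset.sum_congr rfl fun i _ => ?_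
    have hp : ((‖z‖ : ℂ) ^ 2 - 1) ^ i = (-1) ^ i * (1 - (‖z‖ : ℂ) ^ 2) ^ i := by
      rw [← mul_pow]; ring
    rw [hp]
    ring
  simp only [hexp]
  rw [MeasureTheory.integral_finsetSum]
  · simp only [MeasureTheory.integral_const_mul]
    rw [Finset.sum_congr rfl fun i hi => by
      rw [integral_diskPoly_mul_monomial_mul_pow α i hmn hk h
        (Nat.lt_succ_iff.1 (Finset.mem_range.1 hi))], ← Finset.sum_mul]
    split_ifs with hkm
    · subst hkm
      obtain rfl : l = n := by omega
      simp only [mul_comm (k.choose _ : ℂ)]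
      rw [sum_choose_mul_choose_div_choose, diskNormConst]
      push_cast
      have hc : ((l + (k + α)).choose k : ℂ) =
          (k + l + α).factorial / (k.factorial * (l + α).factorial) := by
        rw [show l + (k + α) = k + (l + α) by ring, Nat.cast_add_choose, add_assoc]
      rw [hc, ← Nat.choose_symm_add (a := k), Nat.cast_add_choose, ← Nat.choose_symm_add (a := l),
        Nat.cast_add_choose, Nat.factorial_succ (k + l + α)]
      have hf : ∀ i : ℕ, (i.factorial : ℂ) ≠ 0 := fun i =>
        Nat.cast_ne_zero.2 (Nat.factorial_ne_zero i)
      have := hf k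
      have := hf l
      have := hf α
      have := hf (k + α)
      have := hf (l + α)
      have := hf (k + l + α)
      have h1 : (k : ℂ) + l + α + 1 ≠ 0 := by exact_mod_cast Nat.succ_ne_zero (k + l + α)
      have h2 : (α : ℂ) + 1 ≠ 0 := by exact_mod_cast Nat.succ_ne_zero α
      push_cast
      field_simp
    · simp
  · intro i _
    refine (integrableOn_closedBall_of_continuous ?_).const_mul _
    have := continuous_diskPoly α m n
    have : Continuous fun z : ℂ => conj z := Complex.continuous_conj
    fun_prop

theorem diskNormConst_comm (α m n : ℕ) : diskNormConst α m n = diskNormConst α n m := by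
  unfold diskNormConst
  ring

theorem integral_conj_symm (α m n k l : ℕ) :
    ∫ z in Metric.closedBall (0 : ℂ) 1,
      diskPoly α m n z * conj (diskPoly α k l z) * (1 - (‖z‖ : ℂ) ^ 2) ^ α =
    conj (∫ z in Metric.closedBall (0 : ℂ) 1,
      diskPoly α k l z * conj (diskPoly α m n z) * (1 - (‖z‖ : ℂ) ^ 2) ^ α) := by
  rw [← integral_conj]
  refine MeasureTheory.integral_congr_ae (Filter.Eventually.of_forall fun z => ?_)
  simp only [map_mul, map_pow, map_sub, map_one, Complex.conj_conj, Complex.conj_ofReal]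
  ring

theorem integral_swap_indices (α m n k l : ℕ) :
    ∫ z in Metric.closedBall (0 : ℂ) 1,
      diskPoly α m n z * conj (diskPoly α k l z) * (1 - (‖z‖ : ℂ) ^ 2) ^ α =
    ∫ z in Metric.closedBall (0 : ℂ) 1,
      diskPoly α l k z * conj (diskPoly α n m z) * (1 - (‖z‖ : ℂ) ^ 2) ^ α := by
  refine MeasureTheory.integral_congr_ae (Filter.Eventually.of_forall fun z => ?_)
  simp only [diskPoly_conj_symm]
  ring

/-- Orthogonality of the disk polynomials. -/
theorem integral_diskPoly_mul_conj (α m n k l : ℕ) :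
    ∫ z in Metric.closedBall (0 : ℂ) 1,
      diskPoly α m n z * conj (diskPoly α k l z) * (1 - (‖z‖ : ℂ) ^ 2) ^ α =
      if (k, l) = (m, n) then (Real.pi : ℂ) / ((α + 1) * diskNormConst α m n) else 0 := by
  by_cases h : m + l = n + k
  · have hiff : (k, l) = (m, n) ↔ k = m := by
      rw [Prod.mk.injEq]; omega
    simp only [hiff]
    have hreal : conj ((Real.pi : ℂ) / ((α + 1) * diskNormConst α m n)) =
        (Real.pi : ℂ) / ((α + 1) * diskNormConst α m n) := by simp
    -- Conjugating the integral exchanges the two polynomials, and the conjugation symmetry of each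
    -- exchanges its indices; this reduces all cases to m ≤ n, k ≤ m.
    rcases le_total m n with hmn | hmn <;> rcases le_total k m with hk | hk
    · exact integral_diskPoly_mul_conj_of_le α hmn hk h
    · rw [integral_conj_symm, integral_diskPoly_mul_conj_of_le α (by omega) hk (by omega)]
      split_ifs with h1 h2 h2
      · subst h1
        obtain rfl : l = n := by omega
        exact hreal
      all_goals first | omega | simp
    · rw [integral_swap_indices, integral_conj_symm,
        integral_diskPoly_mul_conj_of_le α hmn (by omega) (by omega)]
      split_ifs with h1 h2 h2
      · rw [diskNormConst_comm]
        exact hreal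
      all_goals first | omega | simp
    · rw [integral_swap_indices,
        integral_diskPoly_mul_conj_of_le α (by omega) (by omega) (by omega)]
      split_ifs with h1 h2 h2
      · subst h2
        obtain rfl : l = n := by omega
        rw [diskNormConst_comm]
      all_goals first | omega | simp
  · rw [if_neg (by rw [Prod.mk.injEq]; omega)]
    refine integral_closedBall_eq_zero_of_rotation h fun u z hu => ?_
    rw [diskPoly_mul_of_norm_eq_one α m n hu, diskPoly_mul_of_norm_eq_one α k l hu, norm_mul, hu,
      one_mul]
    simp only [map_mul, map_pow, Complex.conj_conj]
    ring

/-! ### Coefficients of an expansion as Fourier coefficients. -/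

theorem norm_one_sub_norm_sq_pow_le (α : ℕ) {z : ℂ} (hz : ‖z‖ ≤ 1) :
    ‖(1 - (‖z‖ : ℂ) ^ 2) ^ α‖ ≤ 1 := by
  have h0 : 0 ≤ 1 - ‖z‖ ^ 2 := by nlinarith [norm_nonneg z]
  have h1 : 1 - ‖z‖ ^ 2 ≤ 1 := by nlinarith [norm_nonneg z]
  have : (1 - (‖z‖ : ℂ) ^ 2) ^ α = (((1 - ‖z‖ ^ 2) ^ α : ℝ) : ℂ) := by push_cast; rfl
  rw [this, Complex.norm_real, Real.norm_of_nonneg (pow_nonneg h0 _)]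
  exact pow_le_one₀ h0 h1

/-- The coefficients of a nonnegative summable expansion in disk polynomials are its Fourier
coefficients. -/
theorem eq_diskCoeff_of_hasSum {α : ℕ} {φ : ℂ → ℂ} {b : ℕ → ℕ → ℝ} (hb : ∀ m n, 0 ≤ b m n)
    (hsum : Summable fun p : ℕ × ℕ => b p.1 p.2)
    (hexp : ∀ z ∈ Metric.closedBall (0 : ℂ) 1,
      HasSum (fun p : ℕ × ℕ => (b p.1 p.2 : ℂ) * diskPoly α p.1 p.2 z) (φ z)) (m n : ℕ) :
    (b m n : ℂ) = diskCoeff α φ m n := by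
  have hint : HasSum
      (fun p : ℕ × ℕ => ∫ z in Metric.closedBall (0 : ℂ) 1,
        (b p.1 p.2 : ℂ) * diskPoly α p.1 p.2 z *
          (conj (diskPoly α m n z) * (1 - (‖z‖ : ℂ) ^ 2) ^ α))
      (∫ z in Metric.closedBall (0 : ℂ) 1,
        φ z * (conj (diskPoly α m n z) * (1 - (‖z‖ : ℂ) ^ 2) ^ α)) := by
    -- The constants b_p dominate, since both disk polynomials and the density factor are at most 1
    -- in modulus.
    refine MeasureTheory.hasSum_integral_of_dominated_convergence (fun p _ => b p.1 p.2)
      (fun p => ?_) (fun p => ?_) (Filter.Eventually.of_forall fun _ => hsum) ?_ ?_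
    · refine Continuous.aestronglyMeasurable ?_
      have := continuous_diskPoly α m n
      have := continuous_diskPoly α p.1 p.2
      have := Complex.continuous_conj.comp (continuous_diskPoly α m n)
      simp only [Function.comp_def] at this
      fun_prop
    · refine MeasureTheory.ae_restrict_of_forall_mem measurableSet_closedBall fun z hz => ?_
      have hz' : ‖z‖ ≤ 1 := mem_closedBall_zero_iff.1 hz
      rw [norm_mul, norm_mul, norm_mul, Complex.norm_real, Real.norm_of_nonneg (hb _ _),
        Complex.norm_conj, mul_assoc]
      refine mul_le_of_le_one_right (hb _ _) (mul_le_one₀ (norm_diskPoly_le_one _ _ _ hz')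
        (by positivity) (mul_le_one₀ (norm_diskPoly_le_one _ _ _ hz') (norm_nonneg _)
          (norm_one_sub_norm_sq_pow_le _ hz')))
    · exact MeasureTheory.integrableOn_const MeasureTheory.measure_closedBall_lt_top.ne
    · exact MeasureTheory.ae_restrict_of_forall_mem measurableSet_closedBall fun z hz =>
        (hexp z hz).mul_right _
  have hterm : ∀ p : ℕ × ℕ, ∫ z in Metric.closedBall (0 : ℂ) 1,
        (b p.1 p.2 : ℂ) * diskPoly α p.1 p.2 z *
          (conj (diskPoly α m n z) * (1 - (‖z‖ : ℂ) ^ 2) ^ α) =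
      b p.1 p.2 * if (m, n) = p then (Real.pi : ℂ) / ((α + 1) * diskNormConst α p.1 p.2)
        else 0 := by
    intro p
    rw [← integral_diskPoly_mul_conj α p.1 p.2 m n, ← MeasureTheory.integral_const_mul]
    refine MeasureTheory.integral_congr_ae (Filter.Eventually.of_forall fun z => ?_)
    beta_reduce
    ring
  simp only [hterm] at hint
  have hval := hint.unique (hasSum_single (m, n) fun p hp => by rw [if_neg hp.symm, mul_zero])
  have hpull : ∫ z in Metric.closedBall (0 : ℂ) 1,
      φ z * conj (diskPoly α m n z) *
        (((((α : ℝ) + 1) / Real.pi) * (1 - ‖z‖ ^ 2) ^ α : ℝ) : ℂ) =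
      (((α : ℂ) + 1) / Real.pi) * ∫ z in Metric.closedBall (0 : ℂ) 1,
        φ z * (conj (diskPoly α m n z) * (1 - (‖z‖ : ℂ) ^ 2) ^ α) := by
    rw [← MeasureTheory.integral_const_mul]
    refine MeasureTheory.integral_congr_ae (Filter.Eventually.of_forall fun z => ?_)
    push_cast
    ring
  rw [diskCoeff, hpull, hval, if_pos rfl]
  have h1 : (α : ℂ) + 1 ≠ 0 := by exact_mod_cast Nat.succ_ne_zero α
  have h2 : (diskNormConst α m n : ℂ) ≠ 0 :=
    Complex.ofReal_ne_zero.2 (diskNormConst_pos α m n).ne'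
  have h3 : (Real.pi : ℂ) ≠ 0 := Complex.ofReal_ne_zero.2 Real.pi_ne_zero
  field_simp

/-! ### Descent from ℂ^{q+1} to ℂ^q. -/

theorem MemUpsilon.of_succ {q : ℕ} {φ : ℂ → ℂ} (h : MemUpsilon (q + 1) φ) : MemUpsilon q φ where
  continuousOn := h.continuousOn
  map_one := h.map_one
  posDef N z hz hnorm c := by
    -- Appending a zero coordinate preserves inner products.
    set e : EuclideanSpace ℂ (Fin q) → EuclideanSpace ℂ (Fin (q + 1)) :=
      fun x => WithLp.toLp 2 (Fin.snoc (α := fun _ => ℂ) x 0) with he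
    have hinner : ∀ x y, inner ℂ (e x) (e y) = (inner ℂ x y : ℂ) := by
      intro x y
      simp [he, PiLp.inner_apply, Fin.sum_univ_castSucc]
    have hinj : Function.Injective e := by
      intro x y hxy
      ext i
      have := congrArg (fun v : EuclideanSpace ℂ (Fin (q + 1)) => v i.castSucc) hxy
      simpa [he] using this
    have hn : ∀ x, ‖e x‖ = ‖x‖ := by
      intro x
      rw [@norm_eq_sqrt_re_inner ℂ, @norm_eq_sqrt_re_inner ℂ, hinner]
    simpa only [hinner] using h.posDef N (fun i => e (z i)) (hinj.comp hz)
      (fun i => (hn _).trans (hnorm i)) c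

/-- The terms of the expansion of `∑ a_{m,n} R^{α+1}_{m,n}` in disk polynomials of parameter `α`,
indexed by the pair `(m, n)` and the index of the connection formula. -/
noncomputable def connectionTerm (α : ℕ) (a : ℕ → ℕ → ℝ) (x : (ℕ × ℕ) × ℕ) : ℝ :=
  if x.2 ≤ min x.1.1 x.1.2 then
    weight (α + 2) x.2 (x.1.1 - x.2 + 1) (x.1.2 - x.2) * a x.1.1 x.1.2 else 0

theorem connectionTerm_nonneg (α : ℕ) {a : ℕ → ℕ → ℝ} (ha : ∀ m n, 0 ≤ a m n)
    (x : (ℕ × ℕ) × ℕ) : 0 ≤ connectionTerm α a x := by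
  unfold connectionTerm
  split_ifs
  · exact mul_nonneg (weight_pos _ _ _ _).le (ha _ _)
  · exact le_rfl

theorem connectionTerm_of_lt (α : ℕ) (a : ℕ → ℕ → ℝ) (p : ℕ × ℕ) {j : ℕ}
    (hj : j ∉ Finset.range (min p.1 p.2 + 1)) : connectionTerm α a (p, j) = 0 := by
  rw [Finset.mem_range] at hj
  rw [connectionTerm, if_neg]
  simp only
  omega

theorem hasSum_connectionTerm_fiber (α : ℕ) (a : ℕ → ℕ → ℝ) (p : ℕ × ℕ) :
    HasSum (fun j => connectionTerm α a (p, j)) (a p.1 p.2) := by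
  have h : HasSum _ (∑ j ∈ Finset.range (min p.1 p.2 + 1), connectionTerm α a (p, j)) :=
    hasSum_sum_of_ne_finset_zero fun j hj => connectionTerm_of_lt α a p hj
  convert h using 1
  rw [← one_mul (a p.1 p.2), ← sum_weight_eq_one α p.1 p.2, Finset.sum_mul]
  refine Finset.sum_congr rfl fun j hj => ?_
  rw [connectionTerm, if_pos (Nat.lt_succ_iff.1 (Finset.mem_range.1 hj))]

theorem summable_connectionTerm (α : ℕ) {a : ℕ → ℕ → ℝ} (ha : ∀ m n, 0 ≤ a m n)
    (hsum : Summable fun p : ℕ × ℕ => a p.1 p.2) : Summable (connectionTerm α a) := by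
  rw [summable_prod_of_nonneg fun x => connectionTerm_nonneg α ha x]
  refine ⟨fun p => (hasSum_connectionTerm_fiber α a p).summable, ?_⟩
  simpa only [(hasSum_connectionTerm_fiber α a _).tsum_eq] using hsum

/-- The map `((m, n), j) ↦ ((m + j, n + j), j)`. -/
def diagonalShift (x : (ℕ × ℕ) × ℕ) : (ℕ × ℕ) × ℕ := ((x.1.1 + x.2, x.1.2 + x.2), x.2)

theorem diagonalShift_injective : Function.Injective diagonalShift := by
  rintro ⟨⟨m, n⟩, j⟩ ⟨⟨m', n'⟩, j'⟩ h
  simp only [diagonalShift, Prod.mk.injEq] at h ⊢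
  omega

theorem connectionTerm_eq_zero_of_notMem_range (α : ℕ) (a : ℕ → ℕ → ℝ) {x : (ℕ × ℕ) × ℕ}
    (hx : x ∉ Set.range diagonalShift) : connectionTerm α a x = 0 := by
  obtain ⟨⟨M, N⟩, j⟩ := x
  rw [connectionTerm, if_neg]
  intro h
  simp only [le_min_iff] at h
  exact hx ⟨((M - j, N - j), j), by
    simp only [diagonalShift, Nat.sub_add_cancel h.1, Nat.sub_add_cancel h.2]⟩

theorem connectionTerm_diagonalShift (α : ℕ) (a : ℕ → ℕ → ℝ) (p : ℕ × ℕ) (j : ℕ) :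
    connectionTerm α a (diagonalShift (p, j)) =
      weight (α + 2) j (p.1 + 1) p.2 * a (p.1 + j) (p.2 + j) := by
  simp [connectionTerm, diagonalShift]

theorem summable_weight_mul (α : ℕ) {a : ℕ → ℕ → ℝ} (ha : ∀ m n, 0 ≤ a m n)
    (hsum : Summable fun p : ℕ × ℕ => a p.1 p.2) (m n : ℕ) :
    Summable fun j : ℕ => weight (α + 2) j (m + 1) n * a (m + j) (n + j) := by
  have h := ((summable_connectionTerm α ha hsum).comp_injective
    diagonalShift_injective).prod_factor (m, n)
  simpa only [Function.comp_apply, connectionTerm_diagonalShift] using h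

/-- One summable family is summed in two ways: over j at fixed (M, N), where the weights add to one,
and over j at fixed (M - j, N - j). -/
theorem hasSum_prod_tsum_weight_mul (α : ℕ) {a : ℕ → ℕ → ℝ} (ha : ∀ m n, 0 ≤ a m n)
    (hsum : Summable fun p : ℕ × ℕ => a p.1 p.2) :
    HasSum (fun p : ℕ × ℕ =>
      ∑' j : ℕ, weight (α + 2) j (p.1 + 1) p.2 * a (p.1 + j) (p.2 + j))
      (∑' p : ℕ × ℕ, a p.1 p.2) := by
  have hs := summable_connectionTerm α ha hsum
  have h1 := hs.hasSum.prod_fiberwise fun p => hasSum_connectionTerm_fiber α a p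
  have h2 := (diagonalShift_injective.hasSum_iff
    fun x hx => connectionTerm_eq_zero_of_notMem_range α a hx).2 hs.hasSum
  rw [h1.tsum_eq]
  refine h2.prod_fiberwise fun p => ?_
  simpa only [Function.comp_apply, connectionTerm_diagonalShift]
    using (summable_weight_mul α ha hsum p.1 p.2).hasSum

/-- The same double summation with disk polynomials attached; their bound by 1 keeps the family
summable. -/
theorem hasSum_tsum_weight_mul_diskPoly (α : ℕ) {a : ℕ → ℕ → ℝ} (ha : ∀ m n, 0 ≤ a m n)
    (hsum : Summable fun p : ℕ × ℕ => a p.1 p.2) {z w : ℂ} (hz : ‖z‖ ≤ 1)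
    (hexp : HasSum (fun p : ℕ × ℕ => (a p.1 p.2 : ℂ) * diskPoly (α + 1) p.1 p.2 z) w) :
    HasSum (fun p : ℕ × ℕ =>
      ((∑' j : ℕ, weight (α + 2) j (p.1 + 1) p.2 * a (p.1 + j) (p.2 + j) : ℝ) : ℂ) *
        diskPoly α p.1 p.2 z) w := by
  set G : (ℕ × ℕ) × ℕ → ℂ := fun x =>
    (connectionTerm α a x : ℂ) * diskPoly α (x.1.1 - x.2) (x.1.2 - x.2) z with hG
  have hGs : Summable G := by
    refine Summable.of_norm_bounded (summable_connectionTerm α ha hsum) fun x => ?_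
    rw [hG, norm_mul, Complex.norm_real, Real.norm_of_nonneg (connectionTerm_nonneg α ha x)]
    exact mul_le_of_le_one_right (connectionTerm_nonneg α ha x) (norm_diskPoly_le_one _ _ _ hz)
  have hfiber : ∀ p : ℕ × ℕ, HasSum (fun j => G (p, j))
      ((a p.1 p.2 : ℂ) * diskPoly (α + 1) p.1 p.2 z) := by
    intro p
    have h : HasSum _ (∑ j ∈ Finset.range (min p.1 p.2 + 1), G (p, j)) :=
      hasSum_sum_of_ne_finset_zero fun j hj => by simp [hG, connectionTerm_of_lt α a p hj]
    convert h using 1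
    rw [diskPoly_succ_eq_sum_weight, Finset.mul_sum]
    refine Finset.sum_congr rfl fun j hj => ?_
    simp only [hG, connectionTerm]
    rw [if_pos (Nat.lt_succ_iff.1 (Finset.mem_range.1 hj))]
    push_cast
    ring
  have hGw : HasSum G w := (hGs.hasSum.prod_fiberwise hfiber).unique hexp ▸ hGs.hasSum
  have h2 := (diagonalShift_injective.hasSum_iff fun x hx => by
    simp [hG, connectionTerm_eq_zero_of_notMem_range α a hx]).2 hGw
  refine h2.prod_fiberwise fun p => ?_
  have h3 := (Complex.hasSum_ofReal.2 (summable_weight_mul α ha hsum p.1 p.2).hasSum).mul_right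
    (diskPoly α p.1 p.2 z)
  refine h3.congr_fun fun j => ?_
  simp only [Function.comp_apply, hG, connectionTerm_diagonalShift]
  simp [diagonalShift]

theorem IsSchoenbergPair.eq_diskCoeff {α : ℕ} {φ : ℂ → ℂ} {b : ℕ → ℕ → ℝ}
    (h : IsSchoenbergPair (α + 2) φ b) (m n : ℕ) : (b m n : ℂ) = diskCoeff α φ m n :=
  eq_diskCoeff_of_hasSum h.nonneg h.hasSum_one.summable h.expansion m n

theorem IsSchoenbergPair.of_succ {α : ℕ} {φ : ℂ → ℂ} {a : ℕ → ℕ → ℝ}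
    (h : IsSchoenbergPair (α + 3) φ a) :
    IsSchoenbergPair (α + 2) φ
      fun m n => ∑' j : ℕ, weight (α + 2) j (m + 1) n * a (m + j) (n + j) where
  memUpsilon := h.memUpsilon.of_succ
  nonneg _ _ := tsum_nonneg fun _ => mul_nonneg (weight_pos _ _ _ _).le (h.nonneg _ _)
  hasSum_one := h.hasSum_one.tsum_eq ▸
    hasSum_prod_tsum_weight_mul α h.nonneg h.hasSum_one.summable
  expansion z hz := hasSum_tsum_weight_mul_diskPoly α h.nonneg h.hasSum_one.summable
    (mem_closedBall_zero_iff.1 hz) (h.expansion z hz)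

end ComplexSphere

theorem theorem3p2 (q : ℕ) (hq : 2 ≤ q) (φ : ℂ → ℂ) (a : ℕ → ℕ → ℝ)
    (h : ComplexSphere.IsSchoenbergPair (q + 1) φ a) :
    ∃ b : ℕ → ℕ → ℝ,
      ComplexSphere.IsSchoenbergPair q φ b ∧
      (∀ b' : ℕ → ℕ → ℝ, ComplexSphere.IsSchoenbergPair q φ b' → b' = b) ∧
      (∀ m n : ℕ, (b m n : ℂ) = ComplexSphere.diskCoeff (q - 2) φ m n) ∧
      (∀ j m n : ℕ, 0 < ComplexSphere.weight q j (m + 1) n) ∧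
      (∀ m n : ℕ,
        HasSum (fun j : ℕ => ComplexSphere.weight q j (m + 1) n * a (m + j) (n + j)) (b m n)) := by
  obtain ⟨α, rfl⟩ := Nat.exists_eq_add_of_le' hq
  have hb := h.of_succ
  refine ⟨_, hb, fun b' hb' => ?_, hb.eq_diskCoeff, ComplexSphere.weight_pos α, fun m n =>
    (ComplexSphere.summable_weight_mul α h.nonneg h.hasSum_one.summable m n).hasSum⟩
  funext m n
  -- Both sequences consist of the Fourier coefficients of φ.
  exact_mod_cast (hb'.eq_diskCoeff m n).trans (hb.eq_diskCoeff m n).symm
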